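/- Let $(\Omega,\mathcal F,P)$ be a probability space, let $Y,\psi$ be real random variables on it with $E|Y|<\infty$ and $E|\psi|<\infty$, and let $X$ be an $\mathbb R^{d}$-valued random variable on it ($d\ge 0$). Write $x^+=\max(0,x)$. Let $\mathrm H_0$ be the hypothesis: there exist, on some probability space, a pair of random variables $(Y',\psi')$ and a sigma-algebra $\mathcal I'$ such that $\sigma(\psi')\subset\mathcal I'$, $Y'\sim Y$, $\psi'\sim\psi$ (equality in distribution) and $E[Y'\mid\mathcal I']=\psi'$ almost surely. Let $\mathrm H_{0X}$ be the hypothesis: there exist, on some extension of the probability space (a probability space $(\Omega',\mathcal F',P')$ with a measure-preserving map $\pi:\Omega'\to\Omega$, on which $X$ stands for $X\circ\pi$), a pair of random variables $(Y',\psi')$ and a sigma-algebra $\mathcal I'\subset\mathcal F'$ such that $\sigma(\psi',X)\subset\mathcal I'$, $Y'|X\sim Y|X$, $\psi'|X\sim\psi|X$ (equality of conditional distributions given $X$, almost surely) and $E[Y'\mid\mathcal I']=\psi'$ almost surely. Then the following statements are equivalent: 1. $\mathrm H_{0X}$ holds; 2. almost surely, $E\big[(y-Y)^+-(y-\psi)^+\mid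 X\big]\ge 0$ for all $y\in\mathbb R$ and $E[Y-\psi\mid X]=0$, where the conditional expectations are computed with a regular conditional distribution of $(Y,\psi)$ given $X$ (so that the exceptional null set does not depend on $y$); 3. for every $y\in\mathbb R$, $E\big[(y-Y)^+-(y-\psi)^+\mid X\big]\ge 0$ almost surely, and $E[Y-\psi\mid X]=0$ almost surely, for arbitrary versions of the conditional expectations. Moreover, if $\mathrm H_{0X}$ holds, then $\mathrm H_0$ holds. -/

import Mathlib

open MeasureTheory ProbabilityTheory

universe u

/-- The hypothesis `H₀`: on some probability space there are random variables `Y'`, `ψ'` with the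
laws of `Y` and `ψ`, and a sigma-algebra `I' ⊇ σ(ψ')`, such that `E[Y' | I'] = ψ'`. -/
def RationalizesRE {Ω : Type u} [MeasurableSpace Ω] (μ : Measure Ω) (Y ψ : Ω → ℝ) : Prop :=
  ∃ (Ω' : Type u) (mΩ' : MeasurableSpace Ω') (μ' : Measure Ω') (_ : IsProbabilityMeasure μ')
    (Y' ψ' : Ω' → ℝ),
    Measurable Y' ∧ Measurable ψ' ∧ Integrable Y' μ' ∧
    μ'.map Y' = μ.map Y ∧ μ'.map ψ' = μ.map ψ ∧
    ∃ I' : MeasurableSpace Ω', I' ≤ mΩ' ∧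
      MeasurableSpace.comap ψ' inferInstance ≤ I' ∧
      μ'[Y' | I'] =ᵐ[μ'] ψ'

/-- The hypothesis `H₀X`: on some extension `π : Ω' → Ω` of the underlying probability space
(on which `X` is read as `X ∘ π`) there are random variables `Y'`, `ψ'` having the same
conditional laws given `X` as `Y` and `ψ`, and a sigma-algebra `I' ⊇ σ(ψ', X)`, such that
`E[Y' | I'] = ψ'`. -/
def RationalizesREGiven {Ω : Type u} [MeasurableSpace Ω] (μ : Measure Ω) [IsProbabilityMeasure μ]
    {d : ℕ} (X : Ω → Fin d → ℝ) (Y ψ : Ω → ℝ) : Prop :=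
  ∃ (Ω' : Type u) (mΩ' : MeasurableSpace Ω') (μ' : Measure Ω') (_ : IsProbabilityMeasure μ')
    (π : Ω' → Ω) (Y' ψ' : Ω' → ℝ),
    MeasurePreserving π μ' μ ∧ Measurable Y' ∧ Measurable ψ' ∧ Integrable Y' μ' ∧
    condDistrib Y' (X ∘ π) μ' =ᵐ[μ.map X] condDistrib Y X μ ∧
    condDistrib ψ' (X ∘ π) μ' =ᵐ[μ.map X] condDistrib ψ X μ ∧
    ∃ I' : MeasurableSpace Ω', I' ≤ mΩ' ∧
      MeasurableSpace.comap (fun ω => (ψ' ω, X (π ω))) inferInstance ≤ I' ∧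
      μ'[Y' | I'] =ᵐ[μ'] ψ'

/-- The version `x ↦ ∫ g dP_{(Y,ψ) | X = x}`, evaluated at `X ω`, of `E[g(Y,ψ) | X]` given by a
regular conditional distribution of `(Y, ψ)` given `X`. The exceptional null set can then be taken
uniformly over a family of functions `g`. -/
noncomputable def regCondExp {Ω : Type u} [MeasurableSpace Ω] (μ : Measure Ω)
    [IsProbabilityMeasure μ] {d : ℕ} (X : Ω → Fin d → ℝ) (Y ψ : Ω → ℝ) (g : ℝ × ℝ → ℝ)
    (ω : Ω) : ℝ :=
  ∫ p, g p ∂(condDistrib (fun ω' => (Y ω', ψ ω')) X μ (X ω))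

open Set Filter Topology

/-! Necessity is conditional Jensen given `I'`, integrated over events of `σ(X) ⊆ I'`; such
integrals depend only on the joint laws of `(X, Y)` and `(X, ψ)`.

Sufficiency is a conditional Strassen theorem on the line, proved by an explicit coupling that is
measurable in `x`. Let `p(x, ·)` and `q(x, ·)` be the quantile functions of `ψ` and `Y` given `X =
x`, and let `u` be uniform. Convex order says that `p - q` has nonnegative integral over every `u ≤
c` and total integral zero (`setIntegral_Iic_sub_nonneg_of_stopLoss`). So the mass `(p - q)⁺` has
the same total as `(q - p)⁺` and lies to its left; the monotone coupling pairs points `α` of the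
first with points `β` of the second, with `α ≤ β`. Then `q(α) < p(α) ≤ p(β) < q(β)`, and swapping
`q`-values between `α` and `β` at rate `1 / (q(β) - q(α))` cancels the drift of the identity
coupling (`exists_martingale_selfCoupling`). The martingale law is then realized on an extension by
sampling from its conditional kernel given `X`. Stop-loss integrals are continuous in `y`, so
rational thresholds give one null set for all `y`. -/

/-- The uniform distribution on the unit interval, as a measure on `ℝ`. -/
noncomputable def unifMeasure : Measure ℝ := volume.restrict (Ioo 0 1)

instance : IsProbabilityMeasure unifMeasure :=
  ⟨by simp [unifMeasure]⟩

lemma ae_unifMeasure_mem : ∀ᵐ u ∂unifMeasure, u ∈ Ioo (0 : ℝ) 1 :=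
  ae_restrict_mem measurableSet_Ioo

/-- The quantile function (left-continuous inverse of the distribution function) of a measure. -/
noncomputable def quantileFn (ν : Measure ℝ) (u : ℝ) : ℝ := sInf {y | u ≤ ν.real (Iic y)}

/-! ### Quantile functions of a single law. -/

section quantile

variable (ν : Measure ℝ) [IsProbabilityMeasure ν]

/-- Right-continuity of the distribution function makes the infimum attained. For `0 < u < 1` the
set is nonempty and bounded below, so `sInf` takes no default value. -/
lemma quantileFn_le_iff {u : ℝ} (hu : u ∈ Ioo (0 : ℝ) 1) (y : ℝ) :
    quantileFn ν u ≤ y ↔ u ≤ ν.real (Iic y) := by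
  have hset : {y | u ≤ ν.real (Iic y)} = {y | u ≤ cdf ν y} := by
    simp only [cdf_eq_real]
  have hbdd : BddBelow {y | u ≤ cdf ν y} := by
    obtain ⟨a, ha⟩ := ((tendsto_cdf_atBot ν).eventually_lt_const hu.1).exists
    refine ⟨a, fun z hz => ?_⟩
    by_contra! h
    exact absurd (hz.trans (monotone_cdf ν h.le)) (not_le.2 ha)
  have hne : {y | u ≤ cdf ν y}.Nonempty :=
    ((tendsto_cdf_atTop ν).eventually_const_le hu.2).exists
  rw [quantileFn, hset, ← cdf_eq_real]
  refine ⟨fun h => ?_, fun h => csInf_le hbdd h⟩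
  refine le_trans ?_ (monotone_cdf ν h)
  refine ge_of_tendsto (((cdf ν).right_continuous (sInf {y | u ≤ cdf ν y})).mono_left
    (nhdsWithin_mono _ Ioi_subset_Ici_self)) ?_
  filter_upwards [self_mem_nhdsWithin] with z hz
  obtain ⟨w, hw, hwz⟩ := exists_lt_of_csInf_lt hne hz
  exact hw.trans (monotone_cdf ν hwz.le)

lemma quantileFn_mono {u v : ℝ} (hu : u ∈ Ioo (0 : ℝ) 1) (hv : v ∈ Ioo (0 : ℝ) 1) (h : u ≤ v) :
    quantileFn ν u ≤ quantileFn ν v :=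
  (quantileFn_le_iff ν hu _).2 (h.trans ((quantileFn_le_iff ν hv _).1 le_rfl))

lemma quantileFn_le_quantileFn {ν₁ ν₂ : Measure ℝ} [IsProbabilityMeasure ν₁]
    [IsProbabilityMeasure ν₂] (h : ∀ y, ν₂.real (Iic y) ≤ ν₁.real (Iic y)) {u : ℝ}
    (hu : u ∈ Ioo (0 : ℝ) 1) : quantileFn ν₁ u ≤ quantileFn ν₂ u :=
  (quantileFn_le_iff ν₁ hu _).2 (((quantileFn_le_iff ν₂ hu _).1 le_rfl).trans (h _))

end quantile

/-! ### Quantile transforms of kernels, jointly measurable in the parameter. -/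

section kernel

variable {E : Type*} [MeasurableSpace E] (κ : Kernel E ℝ)

/-- The quantile function of a Markov kernel, extended by zero outside the unit interval. -/
noncomputable def kernelQuantile (z : E × ℝ) : ℝ :=
  if z.2 ∈ Ioo (0 : ℝ) 1 then quantileFn (κ z.1) z.2 else 0

lemma kernelQuantile_of_mem {x : E} {u : ℝ} (hu : u ∈ Ioo (0 : ℝ) 1) :
    kernelQuantile κ (x, u) = quantileFn (κ x) u := if_pos hu

variable [IsMarkovKernel κ]

lemma measurable_kernelQuantile : Measurable (kernelQuantile κ) := by
  refine measurable_of_Iic fun y => ?_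
  have hm : MeasurableSet {z : E × ℝ | z.2 ∈ Ioo (0 : ℝ) 1} := measurable_snd measurableSet_Ioo
  have h1 : MeasurableSet {z : E × ℝ | z.2 ≤ (κ z.1).real (Iic y)} := by
    refine measurableSet_le measurable_snd ?_
    exact ((κ.measurable_coe measurableSet_Iic).comp measurable_fst).ennreal_toReal
  have : kernelQuantile κ ⁻¹' Iic y =
      ({z | z.2 ∈ Ioo (0 : ℝ) 1} ∩ {z | z.2 ≤ (κ z.1).real (Iic y)}) ∪
      ({z | z.2 ∈ Ioo (0 : ℝ) 1}ᶜ ∩ {_z | 0 ≤ y}) := by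
    ext z
    by_cases hz : z.2 ∈ Ioo (0 : ℝ) 1
    · simp only [kernelQuantile, mem_preimage, hz, if_true, mem_Iic, quantileFn_le_iff (κ z.1) hz]
      simp [show 0 < z.2 ∧ z.2 < 1 from hz]
    · have hz' : ¬ (0 < z.2 ∧ z.2 < 1) := hz
      simp only [kernelQuantile, mem_preimage, hz, if_false, mem_Iic]
      simp [hz']
  rw [this]
  exact (hm.inter h1).union (hm.compl.inter (MeasurableSet.const _))

lemma map_kernelQuantile_unifMeasure (x : E) :
    unifMeasure.map (fun u => kernelQuantile κ (x, u)) = κ x := by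
  have hmeas : Measurable fun u => kernelQuantile κ (x, u) :=
    (measurable_kernelQuantile κ).comp measurable_prodMk_left
  have := Measure.isProbabilityMeasure_map (μ := unifMeasure) hmeas.aemeasurable
  refine Measure.ext_of_Iic _ _ fun y => ?_
  rw [Measure.map_apply hmeas measurableSet_Iic]
  have hae : (fun u => kernelQuantile κ (x, u)) ⁻¹' Iic y =ᵐ[unifMeasure]
      (Iic ((κ x).real (Iic y)) : Set ℝ) := by
    rw [Filter.eventuallyEq_set]
    filter_upwards [ae_unifMeasure_mem] with u hu
    simp only [mem_preimage, mem_Iic, kernelQuantile_of_mem κ hu, quantileFn_le_iff _ hu]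
  rw [measure_congr hae, unifMeasure, Measure.restrict_apply measurableSet_Iic,
    ← ofReal_measureReal (measure_ne_top (κ x) _)]
  set c := (κ x).real (Iic y)
  have hc1 : c ≤ 1 := measureReal_le_one
  refine le_antisymm ?_ ?_
  · calc volume (Iic c ∩ Ioo 0 1) ≤ volume (Ioc 0 c) :=
          measure_mono fun u hu => ⟨hu.2.1, hu.1⟩
      _ = ENNReal.ofReal c := by simp
  · calc ENNReal.ofReal c = volume (Ioo 0 c) := by simp
      _ ≤ volume (Iic c ∩ Ioo 0 1) :=
          measure_mono fun u hu => ⟨hu.2.le, hu.1, hu.2.trans_le hc1⟩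

lemma map_prod_kernelQuantile (m : Measure E) [SFinite m] :
    (m.prod unifMeasure).map (fun z => (z.1, kernelQuantile κ z)) = m ⊗ₘ κ := by
  have hq := measurable_kernelQuantile κ
  refine Measure.ext_of_lintegral _ fun g hg => ?_
  rw [lintegral_map hg (by fun_prop), lintegral_prod _ (by fun_prop),
    Measure.lintegral_compProd hg]
  refine lintegral_congr fun x => ?_
  rw [← map_kernelQuantile_unifMeasure κ x, lintegral_map (by fun_prop) (by fun_prop)]

end kernel

/-! ### The mass-exchange coupling. -/

section coupling

variable {S T : Type*} [MeasurableSpace S] [MeasurableSpace T]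

lemma ae_pos_of_map_eq_withDensity {N : Measure S} {Θ : Measure T} {α : T → S} (hα : Measurable α)
    {r : S → ℝ} (hr : Measurable r) (h : Θ.map α = N.withDensity fun w => ENNReal.ofReal (r w)) :
    ∀ᵐ t ∂Θ, 0 < r (α t) := by
  refine ae_of_ae_map (p := fun w => 0 < r w) hα.aemeasurable ?_
  rw [h, ae_withDensity_iff (by fun_prop)]
  exact ae_of_all _ fun w hw => by simpa using hw

/-- Dividing the mass `r⁺ N` by at least `r` leaves at most `N` on `{0 < r}`. This keeps the
exchanged mass within the available mass. -/
lemma map_withDensity_apply_le {N : Measure S} {Θ : Measure T} {α : T → S} (hα : Measurable α)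
    {r : S → ℝ} (hr : Measurable r) (h : Θ.map α = N.withDensity fun w => ENNReal.ofReal (r w))
    {g : T → ENNReal} (hg : ∀ᵐ t ∂Θ, g t ≤ ENNReal.ofReal (r (α t))⁻¹)
    {A : Set S} (hA : MeasurableSet A) :
    (Θ.withDensity g).map α A ≤ N (A ∩ {w | 0 < r w}) := by
  have hpos : MeasurableSet {w | 0 < r w} := measurableSet_lt measurable_const hr
  calc (Θ.withDensity g).map α A = ∫⁻ t in α ⁻¹' A, g t ∂Θ := by
        rw [Measure.map_apply hα hA, withDensity_apply _ (hα hA)]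
    _ ≤ ∫⁻ t in α ⁻¹' A, ENNReal.ofReal (r (α t))⁻¹ ∂Θ :=
        lintegral_mono_ae (ae_restrict_of_ae hg)
    _ = ∫⁻ w in A, ENNReal.ofReal (r w)⁻¹ ∂(Θ.map α) := by
        rw [setLIntegral_map hA (by fun_prop) hα]
    _ = ∫⁻ w in A, ENNReal.ofReal (r w) * ENNReal.ofReal (r w)⁻¹ ∂N := by
        rw [h, setLIntegral_withDensity_eq_setLIntegral_mul _ (by fun_prop) (by fun_prop) hA]
        rfl
    _ ≤ ∫⁻ w in A, {w | 0 < r w}.indicator 1 w ∂N := by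
        refine lintegral_mono fun w => ?_
        by_cases hw : 0 < r w
        · rw [← ENNReal.ofReal_mul hw.le, mul_inv_cancel₀ hw.ne']
          simp [hw]
        · simp [ENNReal.ofReal_of_nonpos (not_lt.1 hw)]
    _ = N (A ∩ {w | 0 < r w}) := by
        rw [lintegral_indicator_one hpos, Measure.restrict_apply hpos, inter_comm]

lemma setIntegral_withDensity_inv {Θ : Measure T} {r : T → ℝ} (hr : Measurable r)
    (hpos : ∀ᵐ t ∂Θ, 0 < r t) {A : Set T} (hA : MeasurableSet A) :
    ∫ t in A, r t ∂(Θ.withDensity fun t => ENNReal.ofReal (r t)⁻¹) = Θ.real A := by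
  have hac := withDensity_absolutelyContinuous Θ fun t => ENNReal.ofReal (r t)⁻¹
  rw [integral_eq_lintegral_of_nonneg_ae
    (ae_restrict_of_ae (hac.ae_le (hpos.mono fun t ht => ht.le)))
    hr.aestronglyMeasurable, setLIntegral_withDensity_eq_setLIntegral_mul _ (by fun_prop)
    (by fun_prop) hA, measureReal_def]
  congr 1
  rw [← setLIntegral_one]
  refine lintegral_congr_ae (ae_restrict_of_ae (hpos.mono fun t ht => ?_))
  simp only [Pi.mul_apply]
  rw [← ENNReal.ofReal_mul (inv_nonneg.2 ht.le), inv_mul_cancel₀ ht.ne', ENNReal.ofReal_one]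

/-- A symmetric exchange of mass between the regions where `q < p` and `p < q` turns the pair
`(p, q)` into a martingale coupling. -/
theorem exists_martingale_selfCoupling {E : Type*} [MeasurableSpace E] [MeasurableEq E]
    (N : Measure S) [IsFiniteMeasure N] {p q : S → ℝ} (hp : Measurable p) (hq : Measurable q)
    (hpi : Integrable p N) (hqi : Integrable q N) {e : S → E} (he : Measurable e)
    (Θ : Measure T) {α β : T → S} (hα : Measurable α) (hβ : Measurable β)
    (hΘα : Θ.map α = N.withDensity fun w => ENNReal.ofReal (p w - q w))
    (hΘβ : Θ.map β = N.withDensity fun w => ENNReal.ofReal (q w - p w))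
    (hle : ∀ᵐ t ∂Θ, p (α t) ≤ p (β t)) (heq : ∀ t, e (α t) = e (β t)) :
    ∃ Λ : Measure (S × S), Λ.map Prod.fst = N ∧ Λ.map Prod.snd = N ∧
      (∀ᵐ z ∂Λ, e z.1 = e z.2) ∧
      ∀ B, MeasurableSet B → ∫ z in Prod.fst ⁻¹' B, (q z.2 - p z.1) ∂Λ = 0 := by
  have hposα := ae_pos_of_map_eq_withDensity hα (hp.sub hq) hΘα
  have hposβ := ae_pos_of_map_eq_withDensity hβ (hq.sub hp) hΘβ
  simp only [Pi.sub_apply, sub_pos] at hposα hposβ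
  have hrm : Measurable fun t => q (β t) - q (α t) := by fun_prop
  -- The chain `q(α) < p(α) ≤ p(β) < q(β)`.
  have hrpos : ∀ᵐ t ∂Θ, 0 < q (β t) - q (α t) := by
    filter_upwards [hposα, hposβ, hle] with t h1 h2 h3
    linarith
  -- Swapping a unit of mass changes the drift by `q(β) - q(α)`, so with this density the change of
  -- drift is exactly `Θ`.
  set G : Measure T := Θ.withDensity fun t => ENNReal.ofReal (q (β t) - q (α t))⁻¹
  have hGα : ∀ A, MeasurableSet A → G.map α A ≤ N (A ∩ {w | 0 < p w - q w}) := fun A hA => by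
    refine map_withDensity_apply_le hα (hp.sub hq) hΘα ?_ hA
    filter_upwards [hposα, hposβ, hle] with t h1 h2 h3
    exact ENNReal.ofReal_le_ofReal (inv_anti₀ (sub_pos.2 h1) (by simp only [Pi.sub_apply]; linarith))
  have hGβ : ∀ A, MeasurableSet A → G.map β A ≤ N (A ∩ {w | 0 < q w - p w}) := fun A hA => by
    refine map_withDensity_apply_le hβ (hq.sub hp) hΘβ ?_ hA
    filter_upwards [hposα, hposβ, hle] with t h1 h2 h3
    exact ENNReal.ofReal_le_ofReal (inv_anti₀ (sub_pos.2 h2) (by simp only [Pi.sub_apply]; linarith))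
  -- The two exchanged masses live on the disjoint sets `q < p` and `p < q`.
  have hCle : G.map α + G.map β ≤ N := by
    refine Measure.le_iff.2 fun A hA => ?_
    have hm : MeasurableSet (A ∩ {w | 0 < q w - p w}) :=
      hA.inter (measurableSet_lt measurable_const (hq.sub hp))
    calc (G.map α + G.map β) A ≤ N (A ∩ {w | 0 < p w - q w}) + N (A ∩ {w | 0 < q w - p w}) :=
          add_le_add (hGα A hA) (hGβ A hA)
      _ = N ((A ∩ {w | 0 < p w - q w}) ∪ (A ∩ {w | 0 < q w - p w})) := by
          refine (measure_union ?_ hm).symm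
          refine Set.disjoint_left.2 fun w h1 h2 => ?_
          have := h1.2
          have := h2.2
          simp only [mem_ofPred_eq] at *
          linarith
      _ ≤ N A := measure_mono (union_subset inter_subset_left inter_subset_left)
  have hαN : G.map α ≤ N := le_trans (Measure.le_add_right le_rfl) hCle
  have hβN : G.map β ≤ N := le_trans (Measure.le_add_left le_rfl) hCle
  have hCfin : IsFiniteMeasure (G.map α + G.map β) := isFiniteMeasure_of_le N hCle
  set D : Measure S := N - (G.map α + G.map β)
  have hDC : D + (G.map α + G.map β) = N := Measure.sub_add_cancel_of_le hCle
  have hDN : D ≤ N := Measure.sub_le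
  have hαβ : Measurable fun t => (α t, β t) := by fun_prop
  have hβα : Measurable fun t => (β t, α t) := by fun_prop
  have hdiag : Measurable fun w : S => (w, w) := by fun_prop
  have iα : ∀ r : S → ℝ, Measurable r → Integrable r N → Integrable (fun t => r (α t)) G :=
    fun r hr hi => (integrable_map_measure hr.aestronglyMeasurable hα.aemeasurable).1
      (hi.mono_measure hαN)
  have iβ : ∀ r : S → ℝ, Measurable r → Integrable r N → Integrable (fun t => r (β t)) G :=
    fun r hr hi => (integrable_map_measure hr.aestronglyMeasurable hβ.aemeasurable).1
      (hi.mono_measure hβN)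
  -- The untouched mass `D` stays on the diagonal; the rest is swapped symmetrically, so both
  -- marginals remain `N`.
  refine ⟨D.map (fun w => (w, w)) + (G.map (fun t => (α t, β t)) + G.map fun t => (β t, α t)),
    ?_, ?_, ?_, ?_⟩
  · rw [Measure.map_add _ _ measurable_fst, Measure.map_add _ _ measurable_fst,
      Measure.map_map measurable_fst hdiag, Measure.map_map measurable_fst hαβ,
      Measure.map_map measurable_fst hβα]
    simpa [Function.comp_def] using hDC
  · rw [Measure.map_add _ _ measurable_snd, Measure.map_add _ _ measurable_snd,
      Measure.map_map measurable_snd hdiag, Measure.map_map measurable_snd hαβ,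
      Measure.map_map measurable_snd hβα, add_comm (G.map _)]
    simpa [Function.comp_def] using hDC
  · have hm : MeasurableSet {z : S × S | e z.1 = e z.2} :=
      measurableSet_eq_fun (he.comp measurable_fst) (he.comp measurable_snd)
    rw [ae_add_measure_iff, ae_add_measure_iff, ae_map_iff hdiag.aemeasurable hm,
      ae_map_iff hαβ.aemeasurable hm, ae_map_iff hβα.aemeasurable hm]
    exact ⟨ae_of_all _ fun _ => rfl, ae_of_all _ heq, ae_of_all _ fun t => (heq t).symm⟩
  · intro B hB
    have hfm : Measurable fun z : S × S => q z.2 - p z.1 := by fun_prop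
    have hBm : MeasurableSet (Prod.fst ⁻¹' B : Set (S × S)) := measurable_fst hB
    have hi1 : Integrable (fun z : S × S => q z.2 - p z.1) (D.map fun w => (w, w)) :=
      (integrable_map_measure hfm.aestronglyMeasurable hdiag.aemeasurable).2
        ((hqi.sub hpi).mono_measure hDN)
    have hi2 : Integrable (fun z : S × S => q z.2 - p z.1) (G.map fun t => (α t, β t)) :=
      (integrable_map_measure hfm.aestronglyMeasurable hαβ.aemeasurable).2
        ((iβ q hq hqi).sub (iα p hp hpi))
    have hi3 : Integrable (fun z : S × S => q z.2 - p z.1) (G.map fun t => (β t, α t)) :=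
      (integrable_map_measure hfm.aestronglyMeasurable hβα.aemeasurable).2
        ((iα q hq hqi).sub (iβ p hp hpi))
    rw [Measure.restrict_add, Measure.restrict_add,
      integral_add_measure hi1.restrict (hi2.restrict.add_measure hi3.restrict),
      integral_add_measure hi2.restrict hi3.restrict,
      setIntegral_map hBm hfm.aestronglyMeasurable hdiag.aemeasurable,
      setIntegral_map hBm hfm.aestronglyMeasurable hαβ.aemeasurable,
      setIntegral_map hBm hfm.aestronglyMeasurable hβα.aemeasurable]
    change ∫ w in B, (q w - p w) ∂D + (∫ t in α ⁻¹' B, (q (β t) - p (α t)) ∂G +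
      ∫ t in β ⁻¹' B, (q (α t) - p (β t)) ∂G) = 0
    have hf : Measurable fun w => q w - p w := hq.sub hp
    have hfi : Integrable (fun w => q w - p w) N := hqi.sub hpi
    have eN : ∫ w in B, (q w - p w) ∂N = ∫ w in B, (q w - p w) ∂D +
        (∫ t in α ⁻¹' B, (q (α t) - p (α t)) ∂G + ∫ t in β ⁻¹' B, (q (β t) - p (β t)) ∂G) := by
      rw [← setIntegral_map hB hf.aestronglyMeasurable hα.aemeasurable,
        ← setIntegral_map hB hf.aestronglyMeasurable hβ.aemeasurable,
        ← integral_add_measure (hfi.mono_measure hαN).restrict (hfi.mono_measure hβN).restrict,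
        ← Measure.restrict_add, ← integral_add_measure (hfi.mono_measure hDN).restrict
        (hfi.mono_measure hCle).restrict, ← Measure.restrict_add, hDC]
    have eα : ∫ t in α ⁻¹' B, (q (β t) - q (α t)) ∂G = Θ.real (α ⁻¹' B) :=
      setIntegral_withDensity_inv hrm hrpos (hα hB)
    have eβ : ∫ t in β ⁻¹' B, (q (β t) - q (α t)) ∂G = Θ.real (β ⁻¹' B) :=
      setIntegral_withDensity_inv hrm hrpos (hβ hB)
    -- This is the drift of the identity coupling on `B`; by `eα` and `eβ` the swap contributes its
    -- negative.
    have eN' : ∫ w in B, (q w - p w) ∂N = Θ.real (β ⁻¹' B) - Θ.real (α ⁻¹' B) := by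
      rw [integral_eq_lintegral_pos_part_sub_lintegral_neg_part hfi.restrict]
      simp only [neg_sub]
      rw [← withDensity_apply _ hB, ← withDensity_apply _ hB, ← hΘα, ← hΘβ,
        Measure.map_apply hα hB, Measure.map_apply hβ hB]
      rfl
    have e1 : ∫ t in α ⁻¹' B, (q (β t) - p (α t)) ∂G =
        ∫ t in α ⁻¹' B, (q (β t) - q (α t)) ∂G + ∫ t in α ⁻¹' B, (q (α t) - p (α t)) ∂G := by
      refine Eq.trans ?_ (integral_add ((iβ q hq hqi).sub (iα q hq hqi)).restrict
        ((iα q hq hqi).sub (iα p hp hpi)).restrict)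
      exact integral_congr_ae (ae_of_all _ fun t => by simp)
    have e2 : ∫ t in β ⁻¹' B, (q (α t) - p (β t)) ∂G =
        ∫ t in β ⁻¹' B, (q (β t) - p (β t)) ∂G - ∫ t in β ⁻¹' B, (q (β t) - q (α t)) ∂G := by
      refine Eq.trans ?_ (integral_sub ((iβ q hq hqi).sub (iβ p hp hpi)).restrict
        ((iβ q hq hqi).sub (iα q hq hqi)).restrict)
      exact integral_congr_ae (ae_of_all _ fun t => by simp)
    rw [e1, e2, eα, eβ]
    linarith

end coupling

/-! ### Convex order and the conditional Strassen theorem. -/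

/-- Take the threshold `y = Q c`: since `Q` is monotone, `(Q c - Q)⁺` is `Q c - Q` on `u ≤ c` and
zero beyond, while for `P` the restricted integral is at most the stop-loss integral. -/
lemma setIntegral_Iic_sub_nonneg_of_stopLoss {P Q : ℝ → ℝ} (hP : Integrable P unifMeasure)
    (hQ : Integrable Q unifMeasure) (hmono : MonotoneOn Q (Ioo 0 1))
    (hcx : ∀ y, ∫ u, max 0 (y - P u) ∂unifMeasure ≤ ∫ u, max 0 (y - Q u) ∂unifMeasure)
    (hmean : ∫ u, P u ∂unifMeasure = ∫ u, Q u ∂unifMeasure) (c : ℝ) :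
    0 ≤ ∫ u in Iic c, (P u - Q u) ∂unifMeasure := by
  rcases le_or_gt c 0 with h0 | h0
  · rw [setIntegral_measure_zero]
    refine measure_mono_null (fun u hu => ?_) (ae_iff.1 ae_unifMeasure_mem)
    exact fun h => absurd (h.1.trans_le hu) (not_lt.2 h0)
  rcases le_or_gt 1 c with h1 | h1
  · rw [Measure.restrict_eq_self_of_ae_mem (s := Iic c) (ae_unifMeasure_mem.mono fun u hu => hu.2.le.trans h1),
      integral_sub hP hQ, hmean, sub_self]
  have hiP : Integrable (fun u => Q c - P u) unifMeasure := (integrable_const _).sub hP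
  have hiQ : Integrable (fun u => Q c - Q u) unifMeasure := (integrable_const _).sub hQ
  have hiP' : Integrable (fun u => max 0 (Q c - P u)) unifMeasure := by
    simpa only [max_comm] using hiP.pos_part
  have e1 : ∫ u in Iic c, (Q c - P u) ∂unifMeasure ≤ ∫ u, max 0 (Q c - P u) ∂unifMeasure :=
    (integral_mono hiP.restrict hiP'.restrict fun u => le_max_right _ _).trans
      (setIntegral_le_integral hiP' (ae_of_all _ fun u => le_max_left _ _))
  have e2 : ∫ u, max 0 (Q c - Q u) ∂unifMeasure = ∫ u in Iic c, (Q c - Q u) ∂unifMeasure := by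
    rw [← integral_indicator measurableSet_Iic]
    refine integral_congr_ae ?_
    filter_upwards [ae_unifMeasure_mem] with u hu
    by_cases huc : u ≤ c
    · rw [indicator_of_mem (show u ∈ Iic c from huc)]
      exact max_eq_right (sub_nonneg.2 (hmono hu ⟨h0, h1⟩ huc))
    · rw [indicator_of_notMem (show u ∉ Iic c from huc)]
      exact max_eq_left (sub_nonpos.2 (hmono ⟨h0, h1⟩ hu (not_le.1 huc).le))
  have e3 := e1.trans ((hcx (Q c)).trans e2.le)
  have e4 : ∫ u in Iic c, (P u - Q u) ∂unifMeasure =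
      ∫ u in Iic c, (Q c - Q u) ∂unifMeasure - ∫ u in Iic c, (Q c - P u) ∂unifMeasure := by
    rw [← integral_sub hiQ.restrict hiP.restrict]
    exact integral_congr_ae (ae_of_all _ fun u => by simp)
  linarith

section kernel

variable {E : Type*} [MeasurableSpace E]

lemma setIntegral_eq_toReal_sub_withDensity {S : Type*} [MeasurableSpace S] {N : Measure S}
    {f : S → ℝ} (hfi : Integrable f N) {B : Set S} (hB : MeasurableSet B) :
    ∫ w in B, f w ∂N = ((N.withDensity fun w => ENNReal.ofReal (f w)) B).toReal -
      ((N.withDensity fun w => ENNReal.ofReal (-f w)) B).toReal := by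
  rw [integral_eq_lintegral_pos_part_sub_lintegral_neg_part hfi.restrict,
    withDensity_apply _ hB, withDensity_apply _ hB]

/-- Rational thresholds need only one null set; right-continuity of the distribution functions gives
the others. -/
lemma ae_forall_Iic_le_of_compProd_le (m : Measure E) [IsFiniteMeasure m] (κ η : Kernel E ℝ)
    [IsMarkovKernel κ] [IsMarkovKernel η]
    (h : ∀ A : Set E, MeasurableSet A → ∀ c : ℝ, (m ⊗ₘ κ) (A ×ˢ Iic c) ≤ (m ⊗ₘ η) (A ×ˢ Iic c)) :
    ∀ᵐ x ∂m, ∀ c : ℝ, (κ x).real (Iic c) ≤ (η x).real (Iic c) := by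
  have hrat : ∀ r : ℚ, ∀ᵐ x ∂m, κ x (Iic (r : ℝ)) ≤ η x (Iic (r : ℝ)) := fun r => by
    refine ae_le_of_forall_setLIntegral_le_of_sigmaFinite
      (κ.measurable_coe measurableSet_Iic) fun A hA _ => ?_
    have := h A hA r
    rwa [Measure.compProd_apply_prod hA measurableSet_Iic,
      Measure.compProd_apply_prod hA measurableSet_Iic] at this
  filter_upwards [ae_all_iff.2 hrat] with x hx c
  rw [← cdf_eq_real, ← cdf_eq_real, ← (cdf (η x)).iInf_rat_gt_eq c]
  have : Nonempty { r' : ℚ // c < r' } := let ⟨r, hr⟩ := exists_rat_gt c; ⟨⟨r, hr⟩⟩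
  refine le_ciInf fun r => (monotone_cdf (κ x) r.2.le).trans ?_
  rw [cdf_eq_real, cdf_eq_real]
  exact ENNReal.toReal_mono (measure_ne_top _ _) (hx r)

/-- A conditional version of Strassen's theorem on the real line: two Markov kernels which are
almost surely in convex order have a joint martingale coupling. -/
theorem exists_kernel_martingaleCoupling [MeasurableEq E] (m : Measure E) [IsProbabilityMeasure m]
    (κ₁ κ₂ : Kernel E ℝ) [IsMarkovKernel κ₁] [IsMarkovKernel κ₂]
    (h₁ : Integrable (fun z => z.2) (m ⊗ₘ κ₁)) (h₂ : Integrable (fun z => z.2) (m ⊗ₘ κ₂))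
    (hcx : ∀ᵐ x ∂m, ∀ y : ℝ, ∫ z, max 0 (y - z) ∂κ₁ x ≤ ∫ z, max 0 (y - z) ∂κ₂ x)
    (hmean : ∀ᵐ x ∂m, ∫ z, z ∂κ₁ x = ∫ z, z ∂κ₂ x) :
    ∃ L : Measure (E × ℝ × ℝ), L.map (fun z => (z.1, z.2.1)) = m ⊗ₘ κ₁ ∧
      L.map (fun z => (z.1, z.2.2)) = m ⊗ₘ κ₂ ∧
      ∀ B : Set (E × ℝ), MeasurableSet B →
        ∫ z in (fun z : E × ℝ × ℝ => (z.1, z.2.1)) ⁻¹' B, (z.2.2 - z.2.1) ∂L = 0 := by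
  set N : Measure (E × ℝ) := m.prod unifMeasure
  set p := kernelQuantile κ₁ with hpdef
  set q := kernelQuantile κ₂ with hqdef
  have hp : Measurable p := measurable_kernelQuantile κ₁
  have hq : Measurable q := measurable_kernelQuantile κ₂
  have hNp : N.map (fun z => (z.1, p z)) = m ⊗ₘ κ₁ := map_prod_kernelQuantile κ₁ m
  have hNq : N.map (fun z => (z.1, q z)) = m ⊗ₘ κ₂ := map_prod_kernelQuantile κ₂ m
  have hpi : Integrable p N := by
    rw [← hNp] at h₁
    exact h₁.comp_measurable (by fun_prop)
  have hqi : Integrable q N := by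
    rw [← hNq] at h₂
    exact h₂.comp_measurable (by fun_prop)
  have hf : Measurable fun w => p w - q w := hp.sub hq
  have hfi : Integrable (fun w => p w - q w) N := hpi.sub hqi
  have hfiber : ∀ᵐ x ∂m, (∀ c, 0 ≤ ∫ u in Iic c, (p (x, u) - q (x, u)) ∂unifMeasure) ∧
      ∫ u, (p (x, u) - q (x, u)) ∂unifMeasure = 0 := by
    filter_upwards [hcx, hmean, hpi.prod_right_ae, hqi.prod_right_ae] with x hx1 hx2 hx3 hx4
    have hpx : Measurable fun u => p (x, u) := hp.comp measurable_prodMk_left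
    have hqx : Measurable fun u => q (x, u) := hq.comp measurable_prodMk_left
    have ep : ∀ g : ℝ → ℝ, Measurable g → ∫ z, g z ∂κ₁ x = ∫ u, g (p (x, u)) ∂unifMeasure :=
      fun g hg => by
        rw [← map_kernelQuantile_unifMeasure κ₁ x,
          integral_map hpx.aemeasurable hg.aestronglyMeasurable]
    have eq : ∀ g : ℝ → ℝ, Measurable g → ∫ z, g z ∂κ₂ x = ∫ u, g (q (x, u)) ∂unifMeasure :=
      fun g hg => by
        rw [← map_kernelQuantile_unifMeasure κ₂ x,
          integral_map hqx.aemeasurable hg.aestronglyMeasurable]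
    have hmean' : ∫ u, p (x, u) ∂unifMeasure = ∫ u, q (x, u) ∂unifMeasure := by
      rw [← ep (fun z => z) measurable_id, ← eq (fun z => z) measurable_id, hx2]
    refine ⟨setIntegral_Iic_sub_nonneg_of_stopLoss hx3 hx4 ?_ (fun y => ?_) hmean', ?_⟩
    · intro u hu v hv huv
      simp only [hqdef, kernelQuantile_of_mem κ₂ hu, kernelQuantile_of_mem κ₂ hv]
      exact quantileFn_mono (κ₂ x) hu hv huv
    · rw [← ep (fun z => max 0 (y - z)) (by fun_prop), ← eq (fun z => max 0 (y - z)) (by fun_prop)]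
      exact hx1 y
    · rw [integral_sub hx3 hx4, hmean', sub_self]
  set R₁ : Measure (E × ℝ) := N.withDensity fun w => ENNReal.ofReal (p w - q w)
  set R₂ : Measure (E × ℝ) := N.withDensity fun w => ENNReal.ofReal (q w - p w)
  have hfin₁ : IsFiniteMeasure R₁ := isFiniteMeasure_withDensity_ofReal hfi.2
  have hfin₂ : IsFiniteMeasure R₂ := isFiniteMeasure_withDensity_ofReal (hqi.sub hpi).2
  have hsub : ∀ B, MeasurableSet B → ∫ w in B, (p w - q w) ∂N = (R₁ B).toReal - (R₂ B).toReal :=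
    fun B hB => by
      rw [setIntegral_eq_toReal_sub_withDensity hfi hB]
      simp only [neg_sub]
      rfl
  have hprod : ∀ (A : Set E) (B : Set ℝ), ∫ w in A ×ˢ B, (p w - q w) ∂N =
      ∫ x in A, ∫ u in B, (p (x, u) - q (x, u)) ∂unifMeasure ∂m := fun A B =>
    setIntegral_prod _ hfi.integrableOn
  -- Over almost every `x`, the mass where `q < p` lies to the left of the mass where `p < q`.
  have hle : ∀ A : Set E, MeasurableSet A → ∀ c : ℝ, R₂ (A ×ˢ Iic c) ≤ R₁ (A ×ˢ Iic c) := by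
    intro A hA c
    have h0 : 0 ≤ ∫ w in A ×ˢ Iic c, (p w - q w) ∂N := by
      rw [hprod]
      exact integral_nonneg_of_ae (ae_restrict_of_ae (hfiber.mono fun x hx => hx.1 c))
    rw [hsub _ (hA.prod measurableSet_Iic), sub_nonneg] at h0
    exact (ENNReal.toReal_le_toReal (measure_ne_top _ _) (measure_ne_top _ _)).1 h0
  -- Equal conditional means give equal fibre masses, so `R₁` and `R₂` disintegrate over one base
  -- measure.
  have hfst : R₂.fst = R₁.fst := by
    refine Measure.ext fun A hA => ?_
    have h0 : ∫ w in A ×ˢ univ, (p w - q w) ∂N = 0 := by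
      rw [hprod]
      simp only [Measure.restrict_univ]
      exact integral_eq_zero_of_ae (ae_restrict_of_ae (hfiber.mono fun x hx => hx.2))
    rw [hsub _ (hA.prod MeasurableSet.univ), sub_eq_zero, prod_univ] at h0
    rw [Measure.fst_apply hA, Measure.fst_apply hA]
    exact ((ENNReal.toReal_eq_toReal_iff' (measure_ne_top _ _) (measure_ne_top _ _)).1 h0).symm
  set m₀ := R₁.fst
  have hdis₁ : m₀ ⊗ₘ R₁.condKernel = R₁ := R₁.disintegrate R₁.condKernel
  have hdis₂ : m₀ ⊗ₘ R₂.condKernel = R₂ := hfst ▸ R₂.disintegrate R₂.condKernel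
  set Θ := m₀.prod unifMeasure
  -- Monotone coupling of `R₁` and `R₂` in each fibre: both quantile transforms use the same uniform
  -- variable.
  set α : E × ℝ → E × ℝ := fun z => (z.1, kernelQuantile R₁.condKernel z) with hα
  set β : E × ℝ → E × ℝ := fun z => (z.1, kernelQuantile R₂.condKernel z) with hβ
  have hαm : Measurable α := measurable_fst.prodMk (measurable_kernelQuantile _)
  have hβm : Measurable β := measurable_fst.prodMk (measurable_kernelQuantile _)
  have hΘα : Θ.map α = R₁ := (map_prod_kernelQuantile R₁.condKernel m₀).trans hdis₁
  have hΘβ : Θ.map β = R₂ := (map_prod_kernelQuantile R₂.condKernel m₀).trans hdis₂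
  have hNmem : ∀ᵐ z ∂N, z.2 ∈ Ioo (0 : ℝ) 1 :=
    Measure.quasiMeasurePreserving_snd.ae ae_unifMeasure_mem
  have hαmem : ∀ᵐ z ∂Θ, (α z).2 ∈ Ioo (0 : ℝ) 1 :=
    ae_of_ae_map (p := fun z => z.2 ∈ Ioo (0 : ℝ) 1) hαm.aemeasurable
      (by rw [hΘα]; exact (withDensity_absolutelyContinuous _ _).ae_le hNmem)
  have hβmem : ∀ᵐ z ∂Θ, (β z).2 ∈ Ioo (0 : ℝ) 1 :=
    ae_of_ae_map (p := fun z => z.2 ∈ Ioo (0 : ℝ) 1) hβm.aemeasurable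
      (by rw [hΘβ]; exact (withDensity_absolutelyContinuous _ _).ae_le hNmem)
  have hcdf : ∀ᵐ x ∂m₀, ∀ c : ℝ,
      (R₂.condKernel x).real (Iic c) ≤ (R₁.condKernel x).real (Iic c) :=
    ae_forall_Iic_le_of_compProd_le m₀ _ _ (by rwa [hdis₁, hdis₂])
  have hcmp : ∀ᵐ z ∂Θ, p (α z) ≤ p (β z) := by
    filter_upwards [hαmem, hβmem, Measure.quasiMeasurePreserving_fst.ae hcdf,
      Measure.quasiMeasurePreserving_snd.ae ae_unifMeasure_mem] with z h1 h2 h3 h4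
    change p (z.1, (α z).2) ≤ p (z.1, (β z).2)
    rw [hpdef, kernelQuantile_of_mem κ₁ h1, kernelQuantile_of_mem κ₁ h2]
    refine quantileFn_mono (κ₁ z.1) h1 h2 ?_
    change kernelQuantile R₁.condKernel (z.1, z.2) ≤ kernelQuantile R₂.condKernel (z.1, z.2)
    rw [kernelQuantile_of_mem _ h4, kernelQuantile_of_mem _ h4]
    exact quantileFn_le_quantileFn h3 h4
  obtain ⟨Λ, hΛ1, hΛ2, hΛe, hΛ⟩ := exists_martingale_selfCoupling N hp hq hpi hqi
    (measurable_fst : Measurable (Prod.fst : E × ℝ → E)) Θ hαm hβm hΘα hΘβ hcmp fun _ => rfl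
  have hFm : Measurable fun z : (E × ℝ) × (E × ℝ) => (z.1.1, p z.1, q z.2) := by fun_prop
  have hpm : Measurable fun z : E × ℝ => (z.1, p z) := by fun_prop
  have hqm : Measurable fun z : E × ℝ => (z.1, q z) := by fun_prop
  refine ⟨Λ.map fun z => (z.1.1, p z.1, q z.2), ?_, ?_, fun B hB => ?_⟩
  · rw [Measure.map_map (by fun_prop) hFm, ← hNp, ← hΛ1, Measure.map_map hpm measurable_fst]
    rfl
  · rw [Measure.map_map (by fun_prop) hFm, ← hNq, ← hΛ2, Measure.map_map hqm measurable_snd]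
    -- The base point was read from the first copy; `hΛe` identifies it with that of the second.
    refine Measure.map_congr (hΛe.mono fun z hz => ?_)
    simp [hz]
  · have hPm : Measurable fun z : E × ℝ × ℝ => (z.1, z.2.1) := by fun_prop
    rw [setIntegral_map (hPm hB) (by fun_prop) hFm.aemeasurable]
    -- The martingale identity holds given `(x, u)`, hence given the coarser `(x, p (x, u))`.
    exact hΛ _ (hpm hB)

end kernel

/-! ### Realization on an extension, and consequences of equal conditional laws. -/

section extension

variable {Ω : Type u} [MeasurableSpace Ω] {μ : Measure Ω} [IsProbabilityMeasure μ] {d : ℕ}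
  {X : Ω → Fin d → ℝ} {Y ψ : Ω → ℝ}

/-- A martingale coupling of the laws of `(X, ψ)` and `(X, Y)` can be realized on an extension of
the probability space. -/
theorem rationalizesREGiven_of_coupling (hX : Measurable X) (hY : Measurable Y)
    (hψ : Measurable ψ) (hYi : Integrable Y μ) (hψi : Integrable ψ μ)
    (L : Measure ((Fin d → ℝ) × ℝ × ℝ))
    (h₁ : L.map (fun z => (z.1, z.2.1)) = μ.map fun ω => (X ω, ψ ω))
    (h₂ : L.map (fun z => (z.1, z.2.2)) = μ.map fun ω => (X ω, Y ω))
    (hL : ∀ B : Set ((Fin d → ℝ) × ℝ), MeasurableSet B →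
      ∫ z in (fun z : (Fin d → ℝ) × ℝ × ℝ => (z.1, z.2.1)) ⁻¹' B, (z.2.2 - z.2.1) ∂L = 0) :
    RationalizesREGiven μ X Y ψ := by
  have hm₁ : Measurable fun z : (Fin d → ℝ) × ℝ × ℝ => (z.1, z.2.1) := by fun_prop
  have hm₂ : Measurable fun z : (Fin d → ℝ) × ℝ × ℝ => (z.1, z.2.2) := by fun_prop
  have hfst : L.fst = μ.map X := by
    rw [← Measure.fst_map_prodMk hψ (X := X), ← h₁, Measure.fst, Measure.fst,
      Measure.map_map measurable_fst hm₁]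
    rfl
  have hLp : IsProbabilityMeasure L := ⟨by
    have : IsProbabilityMeasure (μ.map X) := Measure.isProbabilityMeasure_map hX.aemeasurable
    rw [← Measure.fst_univ, hfst, measure_univ]⟩
  set κ := L.condKernel with hκ
  have hdis : μ.map X ⊗ₘ κ = L := hfst ▸ L.disintegrate L.condKernel
  -- The new pair is drawn from the conditional law under `L` given `X ω`; its dependence on `ω` is
  -- only through `X`.
  set μ' : Measure (Ω × ℝ × ℝ) := μ ⊗ₘ (κ.comap X hX) with hμ'
  have hJm : Measurable fun w : Ω × ℝ × ℝ => (X w.1, w.2) := by fun_prop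
  have hJ : μ'.map (fun w => (X w.1, w.2)) = L := by
    rw [← hdis]
    refine Measure.ext_of_lintegral _ fun g hg => ?_
    rw [lintegral_map hg hJm, Measure.lintegral_compProd (by fun_prop),
      Measure.lintegral_compProd hg, lintegral_map (by fun_prop) hX]
    rfl
  have hπ : MeasurePreserving Prod.fst μ' μ := ⟨measurable_fst, Measure.fst_compProd μ _⟩
  have hXπ : μ'.map (X ∘ Prod.fst) = μ.map X := by
    rw [← Measure.map_map hX measurable_fst, hπ.map_eq]
  have hJ₁ : μ'.map (fun w => ((X ∘ Prod.fst) w, w.2.1)) = μ.map fun ω => (X ω, ψ ω) := by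
    rw [← h₁, ← hJ, Measure.map_map hm₁ hJm]
    rfl
  have hJ₂ : μ'.map (fun w => ((X ∘ Prod.fst) w, w.2.2)) = μ.map fun ω => (X ω, Y ω) := by
    rw [← h₂, ← hJ, Measure.map_map hm₂ hJm]
    rfl
  have hYi' : Integrable (fun w : Ω × ℝ × ℝ => w.2.2) μ' := by
    have : Integrable (fun z : (Fin d → ℝ) × ℝ => z.2) (μ.map fun ω => (X ω, Y ω)) :=
      (integrable_map_measure (by fun_prop) (by fun_prop)).2 hYi
    rw [← hJ₂] at this
    exact this.comp_measurable (by fun_prop)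
  have hψi' : Integrable (fun w : Ω × ℝ × ℝ => w.2.1) μ' := by
    have : Integrable (fun z : (Fin d → ℝ) × ℝ => z.2) (μ.map fun ω => (X ω, ψ ω)) :=
      (integrable_map_measure (by fun_prop) (by fun_prop)).2 hψi
    rw [← hJ₁] at this
    exact this.comp_measurable (by fun_prop)
  have hcd : ∀ (Z' : Ω × ℝ × ℝ → ℝ) (Z : Ω → ℝ), Measurable Z' → Measurable Z →
      μ'.map (fun w => ((X ∘ Prod.fst) w, Z' w)) = μ.map (fun ω => (X ω, Z ω)) →
      condDistrib Z' (X ∘ Prod.fst) μ' =ᵐ[μ.map X] condDistrib Z X μ := fun Z' Z hZ' hZ h => by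
    rw [← hXπ]
    refine condDistrib_ae_eq_of_measure_eq_compProd _ hZ'.aemeasurable ?_
    rw [h, hXπ, compProd_map_condDistrib hZ.aemeasurable]
  have hI : Measurable fun w : Ω × ℝ × ℝ => (w.2.1, X w.1) := by fun_prop
  refine ⟨Ω × ℝ × ℝ, inferInstance, μ', inferInstance, Prod.fst, fun w => w.2.2, fun w => w.2.1,
    hπ, by fun_prop, by fun_prop, hYi', hcd _ _ (by fun_prop) hY hJ₂,
    hcd _ _ (by fun_prop) hψ hJ₁, _, hI.comap_le, le_rfl, ?_⟩
  refine (ae_eq_condExp_of_forall_setIntegral_eq hI.comap_le hYi' (fun s _ _ => hψi'.integrableOn)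
    ?_ ?_).symm
  · rintro _ ⟨B, hB, rfl⟩ -
    -- `I'` is generated by `(ψ', X)`, whereas `hL` uses the order `(X, ψ')`.
    have h0 := hL (Prod.swap ⁻¹' B) (measurable_swap hB)
    rw [← hJ, setIntegral_map (hm₁ (measurable_swap hB)) (by fun_prop) hJm.aemeasurable] at h0
    rw [eq_comm, ← sub_eq_zero, ← integral_sub hYi'.integrableOn hψi'.integrableOn]
    exact h0
  · have hc : Measurable[MeasurableSpace.comap (fun w : Ω × ℝ × ℝ => (w.2.1, X w.1)) inferInstance]
        fun w : Ω × ℝ × ℝ => (w.2.1, X w.1) := comap_measurable _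
    exact (measurable_fst.comp hc).stronglyMeasurable.aestronglyMeasurable

lemma map_prodMk_eq_of_condDistrib_eq {Ω' : Type*} [MeasurableSpace Ω'] {μ' : Measure Ω'}
    [IsProbabilityMeasure μ'] {π : Ω' → Ω} (hπ : MeasurePreserving π μ' μ) (hX : Measurable X)
    {Z' : Ω' → ℝ} {Z : Ω → ℝ} (hZ' : Measurable Z') (hZ : Measurable Z)
    (h : condDistrib Z' (X ∘ π) μ' =ᵐ[μ.map X] condDistrib Z X μ) :
    μ'.map (fun ω => ((X ∘ π) ω, Z' ω)) = μ.map fun ω => (X ω, Z ω) := by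
  have hXπ : μ'.map (X ∘ π) = μ.map X := by
    rw [← Measure.map_map hX hπ.measurable, hπ.map_eq]
  rw [← compProd_map_condDistrib hZ.aemeasurable, ← compProd_map_condDistrib hZ'.aemeasurable,
    hXπ, Measure.compProd_congr h]

lemma map_eq_of_map_prodMk_eq {Ω Ω' E : Type*} [MeasurableSpace Ω]
    [MeasurableSpace Ω'] [MeasurableSpace E] {μ : Measure Ω} {μ' : Measure Ω'} {U' : Ω' → E} {U : Ω → E} {Z' : Ω' → ℝ} {Z : Ω → ℝ} (hU' : Measurable U')
    (hU : Measurable U) (h : μ'.map (fun ω => (U' ω, Z' ω)) = μ.map fun ω => (U ω, Z ω)) :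
    μ'.map Z' = μ.map Z := by
  rw [← Measure.snd_map_prodMk hU' (Y := Z'), h, Measure.snd_map_prodMk hU]

lemma setIntegral_eq_of_map_prodMk_eq {Ω Ω' E : Type*} [MeasurableSpace Ω]
    [MeasurableSpace Ω'] [MeasurableSpace E] {μ : Measure Ω} {μ' : Measure Ω'} {U' : Ω' → E} {U : Ω → E} {Z' : Ω' → ℝ} {Z : Ω → ℝ} (hU' : Measurable U')
    (hU : Measurable U) (hZ' : Measurable Z') (hZ : Measurable Z)
    (h : μ'.map (fun ω => (U' ω, Z' ω)) = μ.map fun ω => (U ω, Z ω))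
    {g : ℝ → ℝ} (hg : Measurable g) {A : Set E} (hA : MeasurableSet A) :
    ∫ ω in U' ⁻¹' A, g (Z' ω) ∂μ' = ∫ ω in U ⁻¹' A, g (Z ω) ∂μ := by
  have hA' : MeasurableSet (Prod.fst ⁻¹' A : Set (E × ℝ)) := measurable_fst hA
  have hg' : Measurable fun z : E × ℝ => g z.2 := by fun_prop
  have e' := setIntegral_map (μ := μ') (g := fun ω => (U' ω, Z' ω)) hA'
    hg'.aestronglyMeasurable (by fun_prop)
  have e := setIntegral_map (μ := μ) (g := fun ω => (U ω, Z ω)) hA'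
    hg'.aestronglyMeasurable (by fun_prop)
  rw [h] at e'
  exact e'.symm.trans e

lemma rationalizesRE_of_rationalizesREGiven (hX : Measurable X) (hY : Measurable Y)
    (hψ : Measurable ψ) (h : RationalizesREGiven μ X Y ψ) : RationalizesRE μ Y ψ := by
  obtain ⟨Ω', mΩ', μ', hμ', π, Y', ψ', hπ, hY', hψ', hYi', hcY, hcψ, hI⟩ := h
  have hXπ : Measurable (X ∘ π) := hX.comp hπ.measurable
  refine ⟨Ω', mΩ', μ', hμ', Y', ψ', hY', hψ', hYi',
    map_eq_of_map_prodMk_eq hXπ hX (map_prodMk_eq_of_condDistrib_eq hπ hX hY' hY hcY),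
    map_eq_of_map_prodMk_eq hXπ hX (map_prodMk_eq_of_condDistrib_eq hπ hX hψ' hψ hcψ), ?_⟩
  obtain ⟨I', hI', hle, hce⟩ := hI
  refine ⟨I', hI', le_trans ?_ hle, hce⟩
  exact (measurable_fst.comp (comap_measurable fun ω => (ψ' ω, X (π ω)))).comap_le

/-! ### Necessity of the conditional inequalities. -/

lemma integrable_max_zero_sub {Ω : Type*} [MeasurableSpace Ω] {μ : Measure Ω} [IsFiniteMeasure μ]
    {Z : Ω → ℝ} (hZ : Integrable Z μ) (y : ℝ) : Integrable (fun ω => max 0 (y - Z ω)) μ := by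
  have h := ((integrable_const y).sub hZ).pos_part
  simp only [max_comm _ (0 : ℝ)] at h
  exact h

lemma condExp_nonneg_of_forall_setIntegral_nonneg {Ω : Type*} {m m₀ : MeasurableSpace Ω}
    {μ : Measure Ω} [IsFiniteMeasure μ] (hm : m ≤ m₀) {f : Ω → ℝ} (hf : Integrable f μ)
    (h : ∀ s, MeasurableSet[m] s → 0 ≤ ∫ ω in s, f ω ∂μ) : 0 ≤ᵐ[μ] μ[f | m] := by
  -- For the trimmed measure, only sets of the smaller sigma-algebra have to be tested.
  refine ae_le_of_ae_le_trim (hm := hm) ?_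
  refine ae_nonneg_of_forall_setIntegral_nonneg
    (integrable_condExp.trim hm stronglyMeasurable_condExp) fun s hs _ => ?_
  rw [← setIntegral_trim hm stronglyMeasurable_condExp hs, setIntegral_condExp hm hf hs]
  exact h s hs

lemma condExp_conditions_of_rationalizesREGiven (hX : Measurable X) (hY : Measurable Y)
    (hψ : Measurable ψ) (hYi : Integrable Y μ) (hψi : Integrable ψ μ)
    (h : RationalizesREGiven μ X Y ψ) :
    (∀ y : ℝ, 0 ≤ᵐ[μ] μ[fun ω => max 0 (y - Y ω) - max 0 (y - ψ ω) |
        MeasurableSpace.comap X inferInstance]) ∧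
      μ[fun ω => Y ω - ψ ω | MeasurableSpace.comap X inferInstance] =ᵐ[μ] 0 := by
  obtain ⟨Ω', mΩ', μ', hμ', π, Y', ψ', hπ, hY', hψ', hYi', hcY, hcψ, hI⟩ := h
  have hXπ : Measurable (X ∘ π) := hX.comp hπ.measurable
  have hlY := map_prodMk_eq_of_condDistrib_eq hπ hX hY' hY hcY
  have hlψ := map_prodMk_eq_of_condDistrib_eq hπ hX hψ' hψ hcψ
  have hmax : ∀ Z, Integrable Z μ' → ∀ y : ℝ, Integrable (fun ω => max 0 (y - Z ω)) μ' :=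
    fun Z hZ y => integrable_max_zero_sub hZ y
  have hsY : ∀ g : ℝ → ℝ, Measurable g → ∀ A : Set (Fin d → ℝ), MeasurableSet A →
      ∫ ω in X ∘ π ⁻¹' A, g (Y' ω) ∂μ' = ∫ ω in X ⁻¹' A, g (Y ω) ∂μ :=
    fun g hg A hA => setIntegral_eq_of_map_prodMk_eq hXπ hX hY' hY hlY hg hA
  have hsψ : ∀ g : ℝ → ℝ, Measurable g → ∀ A : Set (Fin d → ℝ), MeasurableSet A →
      ∫ ω in X ∘ π ⁻¹' A, g (ψ' ω) ∂μ' = ∫ ω in X ⁻¹' A, g (ψ ω) ∂μ :=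
    fun g hg A hA => setIntegral_eq_of_map_prodMk_eq hXπ hX hψ' hψ hlψ hg hA
  obtain ⟨I', hI', hle, hce⟩ := hI
  have hψi' : Integrable ψ' μ' := integrable_condExp.congr hce
  have hXI : ∀ A, MeasurableSet A → MeasurableSet[I'] (X ∘ π ⁻¹' A) := fun A hA =>
    hle _ ⟨Prod.snd ⁻¹' A, measurable_snd hA, rfl⟩
  constructor
  · intro y
    have iY := integrable_max_zero_sub hYi y
    have iψ := integrable_max_zero_sub hψi y
    have iY' := hmax Y' hYi' y
    have iψ' := hmax ψ' hψi' y
    refine condExp_nonneg_of_forall_setIntegral_nonneg hX.comap_le (iY.sub iψ) ?_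
    rintro _ ⟨A, hA, rfl⟩
    have hg : Measurable fun z : ℝ => max 0 (y - z) := by fun_prop
    -- Jensen for a maximum of two affine functions reduces to monotonicity of conditional
    -- expectation for each.
    have hjensen : (fun ω => max 0 (y - ψ' ω)) ≤ᵐ[μ'] μ'[fun ω => max 0 (y - Y' ω) | I'] := by
      have h1 : μ'[fun ω => y - Y' ω | I'] ≤ᵐ[μ'] μ'[fun ω => max 0 (y - Y' ω) | I'] :=
        condExp_mono ((integrable_const y).sub hYi') iY' (ae_of_all _ fun ω => le_max_right _ _)
      have h2 : 0 ≤ᵐ[μ'] μ'[fun ω => max 0 (y - Y' ω) | I'] :=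
        condExp_nonneg (ae_of_all _ fun ω => le_max_left _ _)
      have h3 : μ'[fun ω => y - Y' ω | I'] =ᵐ[μ'] μ'[fun _ => y | I'] - μ'[Y' | I'] :=
        condExp_sub (integrable_const y) hYi' I'
      rw [condExp_const hI'] at h3
      filter_upwards [h1, h2, h3, hce] with ω a1 a2 a3 a4
      simp only [Pi.sub_apply, a4] at a3
      exact max_le a2 (a3 ▸ a1)
    rw [integral_sub iY.restrict iψ.restrict, sub_nonneg,
      ← hsY _ hg A hA, ← hsψ _ hg A hA,
      ← setIntegral_condExp hI' iY' (hXI A hA)]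
    exact integral_mono_ae iψ'.restrict integrable_condExp.restrict (ae_restrict_of_ae hjensen)
  · refine (ae_eq_condExp_of_forall_setIntegral_eq hX.comap_le (hYi.sub hψi)
      (fun s _ _ => (integrable_zero _ _ _).integrableOn) ?_
      stronglyMeasurable_zero.aestronglyMeasurable).symm
    rintro _ ⟨A, hA, rfl⟩ -
    simp only [Pi.zero_apply, integral_zero]
    rw [eq_comm]
    refine (integral_sub hYi.restrict hψi.restrict).trans ?_
    rw [sub_eq_zero, ← hsY (fun z => z) measurable_id A hA, ← hsψ (fun z => z) measurable_id A hA,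
      ← setIntegral_condExp hI' hYi' (hXI A hA)]
    exact integral_congr_ae (ae_restrict_of_ae hce)

/-! ### Regular versions, a uniform null set, and sufficiency. -/

lemma condExp_ae_eq_regCondExp (hX : Measurable X) (hY : Measurable Y) (hψ : Measurable ψ)
    {g : ℝ × ℝ → ℝ} (hg : Measurable g) (hgi : Integrable (fun ω => g (Y ω, ψ ω)) μ) :
    μ[fun ω => g (Y ω, ψ ω) | MeasurableSpace.comap X inferInstance] =ᵐ[μ]
      regCondExp μ X Y ψ g :=
  condExp_ae_eq_integral_condDistrib hX (hY.prodMk hψ).aemeasurable hg.stronglyMeasurable hgi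

lemma integrable_stopLoss_diff (hYi : Integrable Y μ) (hψi : Integrable ψ μ) (y : ℝ) :
    Integrable (fun ω => max 0 (y - Y ω) - max 0 (y - ψ ω)) μ :=
  (integrable_max_zero_sub hYi y).sub (integrable_max_zero_sub hψi y)

lemma condExp_conditions_of_regCondExp_conditions (hX : Measurable X) (hY : Measurable Y)
    (hψ : Measurable ψ) (hYi : Integrable Y μ) (hψi : Integrable ψ μ)
    (h : ∀ᵐ ω ∂μ,
      (∀ y : ℝ, 0 ≤ regCondExp μ X Y ψ (fun p => max 0 (y - p.1) - max 0 (y - p.2)) ω) ∧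
        regCondExp μ X Y ψ (fun p => p.1 - p.2) ω = 0) :
    (∀ y : ℝ, 0 ≤ᵐ[μ] μ[fun ω => max 0 (y - Y ω) - max 0 (y - ψ ω) |
        MeasurableSpace.comap X inferInstance]) ∧
      μ[fun ω => Y ω - ψ ω | MeasurableSpace.comap X inferInstance] =ᵐ[μ] 0 := by
  constructor
  · intro y
    filter_upwards [h, condExp_ae_eq_regCondExp hX hY hψ
      (g := fun p => max 0 (y - p.1) - max 0 (y - p.2)) (by fun_prop)
      (integrable_stopLoss_diff hYi hψi y)] with ω h1 h2
    rw [h2]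
    exact h1.1 y
  · filter_upwards [h, condExp_ae_eq_regCondExp hX hY hψ (g := fun p => p.1 - p.2) (by fun_prop)
      (hYi.sub hψi)] with ω h1 h2
    rw [h2]
    exact h1.2

/-- The map `z ↦ z⁺` is 1-Lipschitz, so `|p.1 - p.2|` dominates the integrand for all `y` at once.
-/
lemma continuous_integral_stopLoss_diff {ν : Measure (ℝ × ℝ)} [IsFiniteMeasure ν]
    (h : Integrable (fun p => p.1 - p.2) ν) :
    Continuous fun y : ℝ => ∫ p, (max 0 (y - p.1) - max 0 (y - p.2)) ∂ν := by
  refine continuous_of_dominated (bound := fun p => ‖p.1 - p.2‖)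
    (fun y => by fun_prop) (fun y => ae_of_all _ fun p => ?_) h.norm
    (ae_of_all _ fun p => by fun_prop)
  have := abs_max_sub_max_le_abs (y - p.1) (y - p.2) 0
  rw [Real.norm_eq_abs, Real.norm_eq_abs, max_comm 0, max_comm 0]
  refine this.trans_eq ?_
  rw [sub_sub_sub_cancel_left, abs_sub_comm]

/-- The exceptional null set in the conditional stop-loss inequalities can be chosen uniformly in
the threshold. -/
lemma ae_forall_condDistrib_conditions (hX : Measurable X) (hY : Measurable Y)
    (hψ : Measurable ψ) (hYi : Integrable Y μ) (hψi : Integrable ψ μ)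
    (h : (∀ y : ℝ, 0 ≤ᵐ[μ] μ[fun ω => max 0 (y - Y ω) - max 0 (y - ψ ω) |
        MeasurableSpace.comap X inferInstance]) ∧
      μ[fun ω => Y ω - ψ ω | MeasurableSpace.comap X inferInstance] =ᵐ[μ] 0) :
    ∀ᵐ x ∂μ.map X,
      Integrable (fun p : ℝ × ℝ => p.1) (condDistrib (fun ω => (Y ω, ψ ω)) X μ x) ∧
      Integrable (fun p : ℝ × ℝ => p.2) (condDistrib (fun ω => (Y ω, ψ ω)) X μ x) ∧
      (∀ y : ℝ, 0 ≤ ∫ p, (max 0 (y - p.1) - max 0 (y - p.2))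
        ∂(condDistrib (fun ω => (Y ω, ψ ω)) X μ x)) ∧
      ∫ p, (p.1 - p.2) ∂(condDistrib (fun ω => (Y ω, ψ ω)) X μ x) = 0 := by
  set κ := condDistrib (fun ω => (Y ω, ψ ω)) X μ with hκ
  have hpair : AEMeasurable (fun ω => (Y ω, ψ ω)) μ := (hY.prodMk hψ).aemeasurable
  have hi₁ : ∀ᵐ x ∂μ.map X, Integrable (fun p : ℝ × ℝ => p.1) (κ x) :=
    Integrable.condDistrib_ae_map (f := fun z : (Fin d → ℝ) × ℝ × ℝ => z.2.1) hpair
      ((integrable_map_measure (by fun_prop) (by fun_prop)).2 hYi)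
  have hi₂ : ∀ᵐ x ∂μ.map X, Integrable (fun p : ℝ × ℝ => p.2) (κ x) :=
    Integrable.condDistrib_ae_map (f := fun z : (Fin d → ℝ) × ℝ × ℝ => z.2.2) hpair
      ((integrable_map_measure (by fun_prop) (by fun_prop)).2 hψi)
  have hmeas : ∀ g : ℝ × ℝ → ℝ, Measurable g → Measurable fun x => ∫ p, g p ∂κ x :=
    fun g hg => (StronglyMeasurable.integral_condDistrib (Y := fun ω => (Y ω, ψ ω)) (X := X)
      (μ := μ) (f := fun z : (Fin d → ℝ) × ℝ × ℝ => g z.2)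
      (hg.comp measurable_snd).stronglyMeasurable).measurable
  have hrat : ∀ r : ℚ, ∀ᵐ x ∂μ.map X,
      0 ≤ ∫ p, (max 0 ((r : ℝ) - p.1) - max 0 ((r : ℝ) - p.2)) ∂κ x := fun r => by
    rw [ae_map_iff hX.aemeasurable (measurableSet_le measurable_const (hmeas _ (by fun_prop)))]
    filter_upwards [h.1 r, condExp_ae_eq_regCondExp hX hY hψ
      (g := fun p => max 0 ((r : ℝ) - p.1) - max 0 ((r : ℝ) - p.2)) (by fun_prop)
      (integrable_stopLoss_diff hYi hψi r)] with ω h1 h2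
    rw [h2] at h1
    exact h1
  have hzero : ∀ᵐ x ∂μ.map X, ∫ p, (p.1 - p.2) ∂κ x = 0 := by
    rw [ae_map_iff hX.aemeasurable
      (measurableSet_eq_fun (hmeas _ (by fun_prop)) measurable_const)]
    filter_upwards [h.2, condExp_ae_eq_regCondExp hX hY hψ (g := fun p => p.1 - p.2)
      (by fun_prop) (hYi.sub hψi)] with ω h1 h2
    rw [h2] at h1
    exact h1
  filter_upwards [hi₁, hi₂, ae_all_iff.2 hrat, hzero] with x h1 h2 h3 h4
  refine ⟨h1, h2, fun y => ?_, h4⟩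
  have hclosed : IsClosed {y : ℝ | 0 ≤ ∫ p, (max 0 (y - p.1) - max 0 (y - p.2)) ∂κ x} :=
    isClosed_le continuous_const (continuous_integral_stopLoss_diff (h1.sub h2))
  have hsub : range ((↑) : ℚ → ℝ) ⊆
      {y : ℝ | 0 ≤ ∫ p, (max 0 (y - p.1) - max 0 (y - p.2)) ∂κ x} := by
    rintro _ ⟨r, rfl⟩
    exact h3 r
  exact hclosed.closure_subset_iff.2 hsub (Rat.denseRange_cast y)

lemma rationalizesREGiven_of_condDistrib_conditions (hX : Measurable X) (hY : Measurable Y)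
    (hψ : Measurable ψ) (hYi : Integrable Y μ) (hψi : Integrable ψ μ)
    (h : ∀ᵐ x ∂μ.map X,
      Integrable (fun p : ℝ × ℝ => p.1) (condDistrib (fun ω => (Y ω, ψ ω)) X μ x) ∧
      Integrable (fun p : ℝ × ℝ => p.2) (condDistrib (fun ω => (Y ω, ψ ω)) X μ x) ∧
      (∀ y : ℝ, 0 ≤ ∫ p, (max 0 (y - p.1) - max 0 (y - p.2))
        ∂(condDistrib (fun ω => (Y ω, ψ ω)) X μ x)) ∧
      ∫ p, (p.1 - p.2) ∂(condDistrib (fun ω => (Y ω, ψ ω)) X μ x) = 0) :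
    RationalizesREGiven μ X Y ψ := by
  set κ := condDistrib (fun ω => (Y ω, ψ ω)) X μ with hκ
  have hpair : AEMeasurable (fun ω => (Y ω, ψ ω)) μ := (hY.prodMk hψ).aemeasurable
  have hm : IsProbabilityMeasure (μ.map X) := Measure.isProbabilityMeasure_map hX.aemeasurable
  have hpm : Measurable fun ω => (X ω, Y ω, ψ ω) := by fun_prop
  have hM₁ : IsMarkovKernel (κ.map Prod.snd) := Kernel.IsMarkovKernel.map _ measurable_snd
  have hM₂ : IsMarkovKernel (κ.map Prod.fst) := Kernel.IsMarkovKernel.map _ measurable_fst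
  have hc₁ : μ.map X ⊗ₘ κ.map Prod.snd = μ.map fun ω => (X ω, ψ ω) := by
    rw [Measure.compProd_map measurable_snd, compProd_map_condDistrib hpair,
      Measure.map_map (by fun_prop) hpm]
    rfl
  have hc₂ : μ.map X ⊗ₘ κ.map Prod.fst = μ.map fun ω => (X ω, Y ω) := by
    rw [Measure.compProd_map measurable_fst, compProd_map_condDistrib hpair,
      Measure.map_map (by fun_prop) hpm]
    rfl
  have e₁ : ∀ x, ∀ g : ℝ → ℝ, Measurable g → ∫ z, g z ∂κ.map Prod.snd x = ∫ p, g p.2 ∂κ x :=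
    fun x g hg => by
      rw [Kernel.map_apply _ measurable_snd, integral_map (by fun_prop) (by fun_prop)]
  have e₂ : ∀ x, ∀ g : ℝ → ℝ, Measurable g → ∫ z, g z ∂κ.map Prod.fst x = ∫ p, g p.1 ∂κ x :=
    fun x g hg => by
      rw [Kernel.map_apply _ measurable_fst, integral_map (by fun_prop) (by fun_prop)]
  -- The law of `ψ` comes first: it is the smaller one in convex order and the conditioning variable
  -- of the martingale.
  obtain ⟨L, h₁, h₂, hL⟩ := exists_kernel_martingaleCoupling (μ.map X) (κ.map Prod.snd)
    (κ.map Prod.fst)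
    (by rw [hc₁]; exact (integrable_map_measure (by fun_prop) (by fun_prop)).2 hψi)
    (by rw [hc₂]; exact (integrable_map_measure (by fun_prop) (by fun_prop)).2 hYi)
    (by
      filter_upwards [h] with x hx y
      rw [e₁ x (fun z => max 0 (y - z)) (by fun_prop), e₂ x (fun z => max 0 (y - z)) (by fun_prop)]
      have := hx.2.2.1 y
      rwa [integral_sub (integrable_max_zero_sub hx.1 y) (integrable_max_zero_sub hx.2.1 y),
        sub_nonneg] at this)
    (by
      filter_upwards [h] with x hx
      rw [e₁ x (fun z => z) measurable_id, e₂ x (fun z => z) measurable_id]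
      have := hx.2.2.2
      rw [integral_sub hx.1 hx.2.1, sub_eq_zero] at this
      exact this.symm)
  exact rationalizesREGiven_of_coupling hX hY hψ hYi hψi L (h₁.trans hc₁) (h₂.trans hc₂) hL

end extension

theorem mainTheorem3 {Ω : Type u} [MeasurableSpace Ω] (μ : Measure Ω) [IsProbabilityMeasure μ]
    {d : ℕ} (X : Ω → Fin d → ℝ) (Y ψ : Ω → ℝ)
    (hX : Measurable X) (hY : Measurable Y) (hψ : Measurable ψ)
    (hYi : Integrable Y μ) (hψi : Integrable ψ μ) :
    List.TFAE [
      RationalizesREGiven μ X Y ψ,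
      -- almost surely, for all `y` simultaneously
      ∀ᵐ ω ∂μ, (∀ y : ℝ, 0 ≤ regCondExp μ X Y ψ (fun p => max 0 (y - p.1) - max 0 (y - p.2)) ω) ∧
        regCondExp μ X Y ψ (fun p => p.1 - p.2) ω = 0,
      -- for all `y`, almost surely, for arbitrary versions of the conditional expectations
      (∀ y : ℝ, 0 ≤ᵐ[μ] μ[fun ω => max 0 (y - Y ω) - max 0 (y - ψ ω) |
          MeasurableSpace.comap X inferInstance]) ∧
        μ[fun ω => Y ω - ψ ω | MeasurableSpace.comap X inferInstance] =ᵐ[μ] 0] ∧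
    (RationalizesREGiven μ X Y ψ → RationalizesRE μ Y ψ) := by
  refine ⟨?_, rationalizesRE_of_rationalizesREGiven hX hY hψ⟩
  tfae_have 1 → 3 := condExp_conditions_of_rationalizesREGiven hX hY hψ hYi hψi
  tfae_have 2 → 3 := condExp_conditions_of_regCondExp_conditions hX hY hψ hYi hψi
  tfae_have 3 → 1 := fun h => rationalizesREGiven_of_condDistrib_conditions hX hY hψ hYi hψi
    (ae_forall_condDistrib_conditions hX hY hψ hYi hψi h)
  tfae_have 3 → 2 := fun h =>
    (ae_of_ae_map hX.aemeasurable (ae_forall_condDistrib_conditions hX hY hψ hYi hψi h)).mono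
      fun ω hω => hω.2.2
  tfae_finish
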